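/- For an odd prime power $q$, let $\mathrm{dot}_n(x)=x_1^2+\cdots+x_n^2$ on $\mathbb F_q^n$. A subspace $W\subseteq\mathbb F_q^n$ is a $\mathrm{dot}_k$-subspace if $(W,\mathrm{dot}_n|_W)$ is isometrically isomorphic to $(\mathbb F_q^k,\mathrm{dot}_k)$, and the dot-binomial coefficient $\binom nk_d$ is the number of $\mathrm{dot}_k$-subspaces of $(\mathbb F_q^n,\mathrm{dot}_n)$. Let $0<k<n$ be integers. There is a unique real polynomial $P_1$ such that $\binom nk_d=P_1(q)$ for all prime powers $q\equiv1\pmod 4$, and a unique real polynomial $P_3$ such that $\binom nk_d=P_3(q)$ for all prime powers $q\equiv3\pmod 4$. Moreover $$\lim_{x\to1}P_1(x)=\lim_{x\to-1}P_3(x)=L,$$ where $$L=\begin{cases}\binom{(n-1)/2}{(k-1)/2}&n,k\text{ odd},\\[2pt]\binom{(n-1)/2}{k/2}&n\text{ odd},\ k\text{ even},\\[2pt]\binom{n/2}{k/2}&n,k\text{ even},\\[2pt]0&n\text{ even},\ k\text{ odd}.\end{cases}$$ Finally, $L$ is the number of symmetric $k$-sets in $\mathbb Z/(n+1)\mathbb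 Z$, that is, of subsets $A\subseteq\mathbb Z/(n+1)\mathbb Z$ with $A=-A$, $0\notin A$ and $|A|=k$. -/

import Mathlib

open Polynomial

universe u

/-- The quadratic form `dot_n(x) = x₁² + ⋯ + xₙ²` on `Fⁿ`. -/
noncomputable def dotForm (F : Type u) [Field F] (n : ℕ) : QuadraticForm F (Fin n → F) :=
  QuadraticMap.weightedSumSquares F (fun _ : Fin n => (1 : F))

theorem dotForm_apply (F : Type u) [Field F] (n : ℕ) (x : Fin n → F) :
    dotForm F n x = ∑ i, x i ^ 2 := by
  simp [dotForm, QuadraticMap.weightedSumSquares_apply, pow_two]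

/-- A subspace `W` of `(Fⁿ, dot_n)` is a `dot_k`-subspace if `W`, with the restricted form, is
isometrically isomorphic to `(Fᵏ, dot_k)`; in particular `dim W = k`. -/
def IsDotSubspace (F : Type u) [Field F] (n k : ℕ) (W : Submodule F (Fin n → F)) : Prop :=
  ((dotForm F n).comp W.subtype).Equivalent (dotForm F k)

/-- The dot-binomial coefficient over `F`: the number of `dot_k`-subspaces of `(Fⁿ, dot_n)`. -/
noncomputable def dotBinom (F : Type u) [Field F] (n k : ℕ) : ℕ :=
  Set.ncard {W : Submodule F (Fin n → F) | IsDotSubspace F n k W}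

/-- `P` expresses the dot-binomial coefficient as a polynomial in `q`, for all finite fields `𝔽_q`
with `q ≡ r (mod 4)`. -/
def IsDotBinomPolynomial (r n k : ℕ) (P : ℝ[X]) : Prop :=
  ∀ (F : Type u) [Field F] [Finite F], Nat.card F ≡ r [MOD 4] →
    (dotBinom F n k : ℝ) = P.eval (Nat.card F : ℝ)

/-- A symmetric `k`-set in `ℤ/(n+1)ℤ`: `A = -A`, `0 ∉ A` and `|A| = k`. -/
def IsSymmetricSet (n k : ℕ) (A : Finset (ZMod (n + 1))) : Prop :=
  A = A.image (fun a => -a) ∧ 0 ∉ A ∧ A.card = k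

/-! Count orthonormal frames. Every `dot_k`-subspace has |O_k| orthonormal bases
(`dotBinom_mul_frameCount`). Reflections make O_n transitive on unit vectors, so a frame is built
one vector at a time, each choice leaving a copy of the standard space one dimension lower
(`frameCount_succ_succ`). Hence the coefficient is |O_n| / (|O_k| |O_{n-k}|), and |O_n| is a product
of unit sphere sizes.

Let η = ±1 be the quadratic character of -1. Sphere sizes are, up to a power of η, polynomials in ηq
(`sphereCount_one`), so one polynomial P with `orthoPoly n = P * orthoPoly k * orthoPoly (n - k)`
serves both residue classes: P₁ is P(x) and P₃ is ±P(-x). Both limits thus reduce to P(1), read off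
from a Gaussian binomial at X² (`exists_orthoPoly_add`). The sign is +1 except for n even and k odd,
where P(1) = 0. -/

/-! ### Polynomial quotients and their values at 1. -/

/-- The polynomials `s_m` such that the unit sphere of `(𝔽_qᵐ, dot_m)` has `η^(m+1) s_m(η q)`
points, where `η = ±1` is the quadratic character of `-1`. -/
noncomputable def spherePoly : ℕ → ℝ[X]
  | 0 => 0
  | 1 => 2
  | m + 2 => X * spherePoly m + (X - 1) * X ^ m

theorem spherePoly_odd (j : ℕ) : spherePoly (2 * j + 1) = X ^ j * (X ^ j + 1) := by
  induction j with
  | zero => simp [spherePoly]; norm_num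
  | succ j ih =>
    rw [show 2 * (j + 1) + 1 = (2 * j + 1) + 2 by ring, spherePoly, ih]
    ring

theorem spherePoly_even (j : ℕ) : spherePoly (2 * j + 2) = X ^ j * (X ^ (j + 1) - 1) := by
  induction j with
  | zero => simp [spherePoly]
  | succ j ih =>
    rw [show 2 * (j + 1) + 2 = (2 * j + 2) + 2 by ring, spherePoly, ih]
    ring

/-- The product `s_1 ⋯ s_n`, which up to sign counts orthogonal matrices. -/
noncomputable def orthoPoly (n : ℕ) : ℝ[X] := ∏ i ∈ Finset.range n, spherePoly (i + 1)

theorem orthoPoly_succ (n : ℕ) : orthoPoly (n + 1) = orthoPoly n * spherePoly (n + 1) :=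
  Finset.prod_range_succ _ _

/-- The product of `X ^ (2 j) - 1` for `1 ≤ j ≤ a`. -/
noncomputable def evenCycloProd (a : ℕ) : ℝ[X] := ∏ j ∈ Finset.range a, (X ^ (2 * (j + 1)) - 1)

theorem evenCycloProd_succ (a : ℕ) :
    evenCycloProd (a + 1) = evenCycloProd a * (X ^ (2 * (a + 1)) - 1) :=
  Finset.prod_range_succ _ _

theorem evenCycloProd_ne_zero (a : ℕ) : evenCycloProd a ≠ 0 :=
  Finset.prod_ne_zero_iff.mpr fun j _ => X_pow_sub_C_ne_zero (by omega) (1 : ℝ)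

theorem orthoPoly_odd (a : ℕ) : orthoPoly (2 * a + 1) = 2 * X ^ (a ^ 2) * evenCycloProd a := by
  induction a with
  | zero => simp [orthoPoly, evenCycloProd, spherePoly]
  | succ a ih =>
    rw [show 2 * (a + 1) + 1 = 2 * a + 1 + 1 + 1 by ring, orthoPoly_succ, orthoPoly_succ, ih,
      evenCycloProd_succ, show 2 * a + 1 + 1 + 1 = 2 * (a + 1) + 1 by ring, spherePoly_odd,
      spherePoly_even]
    ring

theorem orthoPoly_even (a : ℕ) :
    orthoPoly (2 * a + 2) = 2 * X ^ (a ^ 2 + a) * evenCycloProd a * (X ^ (a + 1) - 1) := by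
  rw [orthoPoly_succ, orthoPoly_odd, spherePoly_even]
  ring

/-- The Gaussian binomial coefficient `[b + c, b]` at `X ^ 2`. -/
noncomputable def gaussSq : ℕ → ℕ → ℝ[X]
  | 0, _ => 1
  | _ + 1, 0 => 1
  | b + 1, c + 1 => gaussSq b (c + 1) + X ^ (2 * (b + 1)) * gaussSq (b + 1) c

/-- The q-Pascal rule: with Y = X², Y^(i+j) - 1 = (Y^i - 1) + Y^i (Y^j - 1). -/
theorem evenCycloProd_add (b c : ℕ) :
    evenCycloProd (b + c) = gaussSq b c * evenCycloProd b * evenCycloProd c := by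
  induction b, c using gaussSq.induct with
  | case1 c => simp [gaussSq, evenCycloProd]
  | case2 b => simp [gaussSq, evenCycloProd]
  | case3 b c h₁ h₂ =>
    rw [show b + 1 + (c + 1) = b + c + 1 + 1 by ring, evenCycloProd_succ, gaussSq]
    rw [show b + (c + 1) = b + c + 1 by ring] at h₁
    rw [show b + 1 + c = b + c + 1 by ring] at h₂
    calc evenCycloProd (b + c + 1) * (X ^ (2 * (b + c + 1 + 1)) - 1)
        = evenCycloProd (b + c + 1) * (X ^ (2 * (b + 1)) - 1)
          + X ^ (2 * (b + 1)) * evenCycloProd (b + c + 1) * (X ^ (2 * (c + 1)) - 1) := by ring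
      _ = _ := by
        nth_rw 1 [h₁]
        rw [h₂, evenCycloProd_succ b, evenCycloProd_succ c]
        ring

theorem eval_one_gaussSq (b c : ℕ) : (gaussSq b c).eval 1 = ((b + c).choose b : ℝ) := by
  induction b, c using gaussSq.induct with
  | case1 c => simp [gaussSq]
  | case2 b => simp [gaussSq]
  | case3 b c h₁ h₂ =>
    rw [gaussSq, show b + 1 + (c + 1) = b + c + 1 + 1 by ring, Nat.choose_succ_succ]
    simp only [eval_add, eval_mul, eval_pow, eval_X, h₁, h₂]
    rw [show b + (c + 1) = b + c + 1 by ring, show b + 1 + c = b + c + 1 by ring]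
    push_cast
    ring

theorem gaussSq_succ_right_mul (b c : ℕ) :
    gaussSq b (c + 1) * (X ^ (2 * (c + 1)) - 1)
      = gaussSq b c * (X ^ (2 * (b + c + 1)) - 1) := by
  have h := evenCycloProd_add b (c + 1)
  rw [← add_assoc, evenCycloProd_succ, evenCycloProd_succ, evenCycloProd_add b c] at h
  refine mul_right_cancel₀ (mul_ne_zero (evenCycloProd_ne_zero b) (evenCycloProd_ne_zero c)) ?_
  linear_combination -h

/-- The number of symmetric `k`-sets in `ℤ/(n+1)ℤ`. -/
def symmetricCount (n k : ℕ) : ℕ := if Even n ∧ Odd k then 0 else (n / 2).choose (k / 2)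

theorem two_mul_C_half : (2 : ℝ[X]) * C (1 / 2) = 1 := by
  rw [show (2 : ℝ[X]) = C 2 from rfl, ← C_mul]
  norm_num

theorem exists_orthoPoly_odd_even (b c : ℕ) : ∃ P : ℝ[X],
    orthoPoly (2 * b + 1 + (2 * c + 2)) = P * orthoPoly (2 * b + 1) * orthoPoly (2 * c + 2) ∧
      P.eval 1 = ((b + c + 1).choose b : ℝ) := by
  -- The last factor is (X^(2(c+1)) - 1) / (X^(c+1) - 1); its value 2 at 1 cancels the 1/2.
  refine ⟨C (1 / 2) * X ^ ((2 * b + 1) * (c + 1)) * gaussSq b (c + 1) * (X ^ (c + 1) + 1), ?_, ?_⟩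
  · rw [show 2 * b + 1 + (2 * c + 2) = 2 * (b + (c + 1)) + 1 by ring, orthoPoly_odd,
      orthoPoly_odd, orthoPoly_even, evenCycloProd_add, evenCycloProd_succ]
    linear_combination (-2 * X ^ ((b + (c + 1)) ^ 2) * gaussSq b (c + 1) * evenCycloProd b *
      evenCycloProd c * (X ^ (2 * (c + 1)) - 1)) * two_mul_C_half
  · simp [eval_one_gaussSq]
    rw [add_assoc]
    ring

theorem exists_orthoPoly_odd_odd (b c : ℕ) : ∃ P : ℝ[X],
    orthoPoly (2 * b + 1 + (2 * c + 1)) = P * orthoPoly (2 * b + 1) * orthoPoly (2 * c + 1) ∧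
      P.eval 1 = 0 := by
  -- The factor X^(b+c+1) - 1 of the even total dimension has nothing to cancel against, whence the
  -- zero at 1.
  refine ⟨C (1 / 2) * X ^ (2 * b * c + b + c) * gaussSq b c * (X ^ (b + c + 1) - 1), ?_, ?_⟩
  · rw [show 2 * b + 1 + (2 * c + 1) = 2 * (b + c) + 2 by ring, orthoPoly_odd,
      orthoPoly_odd, orthoPoly_even, evenCycloProd_add]
    linear_combination (-2 * X ^ ((b + c) ^ 2 + (b + c)) * gaussSq b c * evenCycloProd b *
      evenCycloProd c * (X ^ (b + c + 1) - 1)) * two_mul_C_half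
  · simp

theorem exists_orthoPoly_even_even (b c : ℕ) : ∃ P : ℝ[X],
    orthoPoly (2 * b + 2 + (2 * c + 2)) = P * orthoPoly (2 * b + 2) * orthoPoly (2 * c + 2) ∧
      P.eval 1 = ((b + c + 2).choose (b + 1) : ℝ) := by
  -- With N = b+c+2 and g' = `gaussSq (b + 1) c`, the quotient is, up to a monomial and 1/2, g'
  -- (X^(b+1) + 1)(X^N - 1) / (X^(c+1) - 1). Writing X^(b+1) + 1 = (X^N + 1) - X^(b+1) (X^(c+1) - 1)
  -- and applying `gaussSq_succ_right_mul` removes the denominator.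
  refine ⟨C (1 / 2) * X ^ (2 * (b + 1) * (c + 1)) * (gaussSq (b + 1) (c + 1) * (1 + X ^ (c + 1))
    - X ^ (b + 1) * (X ^ (b + c + 2) - 1) * gaussSq (b + 1) c), ?_, ?_⟩
  · rw [show 2 * b + 2 + (2 * c + 2) = 2 * (b + 1 + c) + 2 by ring, orthoPoly_even,
      orthoPoly_even, orthoPoly_even, evenCycloProd_add, evenCycloProd_succ]
    have h := gaussSq_succ_right_mul (b + 1) c
    generalize gaussSq (b + 1) (c + 1) = g at *
    generalize gaussSq (b + 1) c = g' at *
    generalize evenCycloProd b = B at *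
    generalize evenCycloProd c = D at *
    have h2 := two_mul_C_half
    generalize (C (1 / 2) : ℝ[X]) = t at *
    have hs : 2 * X ^ ((b + 1 + c) ^ 2 + (b + 1 + c)) * (g' * (B * (X ^ (2 * (b + 1)) - 1)) * D) *
        (X ^ (b + 1 + c + 1) - 1) = 2 * X ^ (2 * (b + 1) * (c + 1) + b ^ 2 + b + c ^ 2 + c) * B * D
          * (X ^ (b + 1) - 1) *
        (g * (X ^ (2 * (c + 1)) - 1)
          - X ^ (b + 1) * (X ^ (b + c + 2) - 1) * (X ^ (c + 1) - 1) * g') := by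
      rw [h]
      ring
    rw [hs]
    linear_combination (-2 * X ^ (2 * (b + 1) * (c + 1) + b ^ 2 + b + c ^ 2 + c) * B * D
          * (X ^ (b + 1) - 1) * (g * (X ^ (2 * (c + 1)) - 1)
          - X ^ (b + 1) * (X ^ (b + c + 2) - 1) * (X ^ (c + 1) - 1) * g')) * h2
  · simp [eval_one_gaussSq]
    rw [show b + 1 + (c + 1) = b + c + 2 by ring]
    ring

theorem exists_orthoPoly_add {k l : ℕ} (hk : 0 < k) (hl : 0 < l) : ∃ P : ℝ[X],
    orthoPoly (k + l) = P * orthoPoly k * orthoPoly l ∧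
      P.eval 1 = (symmetricCount (k + l) k : ℝ) := by
  obtain ⟨b, rfl | rfl⟩ : ∃ b, k = 2 * b + 1 ∨ k = 2 * b + 2 := ⟨(k - 1) / 2, by omega⟩ <;>
  obtain ⟨c, rfl | rfl⟩ : ∃ c, l = 2 * c + 1 ∨ l = 2 * c + 2 := ⟨(l - 1) / 2, by omega⟩
  · obtain ⟨P, h, h'⟩ := exists_orthoPoly_odd_odd b c
    refine ⟨P, h, h'.trans ?_⟩
    rw [symmetricCount, if_pos (by grind), Nat.cast_zero]
  · obtain ⟨P, h, h'⟩ := exists_orthoPoly_odd_even b c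
    refine ⟨P, h, h'.trans ?_⟩
    rw [symmetricCount, if_neg (by grind), show (2 * b + 1 + (2 * c + 2)) / 2 = b + c + 1 by omega,
      show (2 * b + 1) / 2 = b by omega]
  · obtain ⟨P, h, h'⟩ := exists_orthoPoly_odd_even c b
    refine ⟨P, by rw [add_comm, h]; ring, h'.trans ?_⟩
    rw [symmetricCount, if_neg (by grind), show (2 * b + 2 + (2 * c + 1)) / 2 = b + 1 + c by omega,
      show (2 * b + 2) / 2 = b + 1 by omega, Nat.choose_symm_add]
    congr 2
    ring
  · obtain ⟨P, h, h'⟩ := exists_orthoPoly_even_even b c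
    refine ⟨P, h, h'.trans ?_⟩
    rw [symmetricCount, if_neg (by grind), show (2 * b + 2 + (2 * c + 2)) / 2 = b + c + 2 by omega,
      show (2 * b + 2) / 2 = b + 1 by omega]

/-! ### Sphere sizes over finite fields. -/

section SphereCount

theorem sum_fin_succ_fun {F M : Type*} [Fintype F] [AddCommMonoid M] (n : ℕ) (f : (Fin (n + 1) → F) → M) :
    ∑ x, f x = ∑ a : F, ∑ y : Fin n → F, f (Matrix.vecCons a y) := by
  rw [← Fintype.sum_prod_type']
  exact (Fintype.sum_equiv (Fin.consEquiv fun _ => F) _ _ fun _ => rfl).symm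

variable {F : Type u} [Field F] [Fintype F] [DecidableEq F]

theorem sum_comp_mul_self (hF : ringChar F ≠ 2) (f : F → ℤ) :
    ∑ x : F, f (x * x) = ∑ u : F, (1 + quadraticChar F u) * f u := by
  rw [← Finset.sum_fiberwise Finset.univ (fun x : F => x * x)]
  refine Finset.sum_congr rfl fun u _ => ?_
  rw [Finset.sum_congr rfl (g := fun _ => f u)
    (fun x hx => congrArg f (Finset.mem_filter.mp hx).2), Finset.sum_const, nsmul_eq_mul,
    add_comm 1, ← quadraticChar_card_sqrts hF u]
  congr 3
  ext x
  simp [pow_two]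

/-- For a ≠ 0, scaling u = a t turns the sum into the Jacobi sum of the quadratic character with
itself, that is, with its inverse. For a = 0 every nonzero term equals χ(-1). -/
theorem sum_quadraticChar_mul_quadraticChar_sub (hF : ringChar F ≠ 2) (a : F) :
    ∑ u : F, quadraticChar F u * quadraticChar F (a - u) =
      -quadraticChar F (-1) + if a = 0 then Fintype.card F * quadraticChar F (-1) else 0 := by
  split_ifs with ha
  · subst ha
    have h : ∀ u : F, quadraticChar F u * quadraticChar F (0 - u) =
        quadraticChar F (-1) * (1 - if u = 0 then 1 else 0) := by
      intro u
      rw [zero_sub, ← neg_one_mul u, map_mul]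
      split_ifs with hu
      · simp [hu]
      · linear_combination quadraticChar F (-1) * quadraticChar_sq_one hu
    rw [Finset.sum_congr rfl fun u _ => h u, ← Finset.mul_sum, Finset.sum_sub_distrib]
    simp
    ring
  · have hinv : (quadraticChar F)⁻¹ = quadraticChar F := (quadraticChar_isQuadratic F).inv
    have hJ := jacobiSum_nontrivial_inv (quadraticChar_ne_one hF)
    rw [hinv, jacobiSum] at hJ
    rw [add_zero, ← hJ]
    refine (Fintype.sum_equiv (Equiv.mulLeft₀ a ha) _ _ fun t => ?_).symm
    rw [Equiv.mulLeft₀_apply, ← mul_one_sub, map_mul, map_mul]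
    linear_combination (-quadraticChar F t * quadraticChar F (1 - t)) * quadraticChar_sq_one ha

theorem sum_ite_mul_self_add_mul_self (hF : ringChar F ≠ 2) (a : F) :
    ∑ x : F, ∑ y : F, (if x * x + y * y = a then 1 else 0 : ℤ) =
      Fintype.card F - quadraticChar F (-1) +
        if a = 0 then Fintype.card F * quadraticChar F (-1) else 0 := by
  have h₁ : ∀ x : F, ∑ y : F, (if x * x + y * y = a then 1 else 0 : ℤ) =
      1 + quadraticChar F (a - x * x) := by
    intro x
    rw [sum_comp_mul_self hF fun v => if x * x + v = a then (1 : ℤ) else 0,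
      Finset.sum_eq_single (a - x * x)]
    · simp
    · intro v _ hv
      rw [if_neg fun h => hv (eq_sub_of_add_eq' h), mul_zero]
    · simp
  have h₂ : ∑ u : F, quadraticChar F (a - u) = 0 := by
    rw [← quadraticChar_sum_zero hF]
    exact Fintype.sum_equiv (Equiv.subLeft a) _ _ fun u => rfl
  rw [Finset.sum_congr rfl fun x _ => h₁ x,
    sum_comp_mul_self hF fun u => 1 + quadraticChar F (a - u)]
  simp only [add_mul, mul_add, Finset.sum_add_distrib, one_mul, mul_one, h₂,
    quadraticChar_sum_zero hF, sum_quadraticChar_mul_quadraticChar_sub hF]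
  simp
  ring

/-- The number of points of `Fⁿ` at which `dot_n` takes the value `c`. -/
noncomputable def sphereCount (F : Type u) [Field F] (n : ℕ) (c : F) : ℕ :=
  Nat.card {x : Fin n → F // x ⬝ᵥ x = c}

theorem sphereCount_eq_sum (n : ℕ) (c : F) :
    (sphereCount F n c : ℤ) = ∑ x : Fin n → F, if x ⬝ᵥ x = c then 1 else 0 := by
  rw [sphereCount, Nat.card_eq_fintype_card, Fintype.card_subtype, Finset.sum_boole]

/-- Split off two coordinates: x² + y² = t has q - η solutions, plus ηq more when t = 0, and t = 0
exactly when the other n coordinates lie on the same sphere. -/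
theorem sphereCount_add_two (hF : ringChar F ≠ 2) (n : ℕ) (c : F) :
    (sphereCount F (n + 2) c : ℤ) =
      Fintype.card F * quadraticChar F (-1) * sphereCount F n c +
        (Fintype.card F - quadraticChar F (-1)) * Fintype.card F ^ n := by
  rw [sphereCount_eq_sum, sum_fin_succ_fun]
  simp_rw [sum_fin_succ_fun, Matrix.cons_dotProduct_cons]
  have h : ∀ a : F, ∑ b : F, ∑ y : Fin n → F,
      (if a * a + (b * b + y ⬝ᵥ y) = c then 1 else 0 : ℤ) =
      ∑ y : Fin n → F, ∑ b : F, (if a * a + b * b = c - y ⬝ᵥ y then 1 else 0 : ℤ) := by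
    intro a
    rw [Finset.sum_comm]
    refine Finset.sum_congr rfl fun y _ => Finset.sum_congr rfl fun b _ => ?_
    simp only [eq_sub_iff_add_eq, add_assoc]
  rw [Finset.sum_congr rfl fun a _ => h a, Finset.sum_comm]
  simp_rw [sum_ite_mul_self_add_mul_self hF]
  rw [Finset.sum_add_distrib, sphereCount_eq_sum, Finset.mul_sum]
  have h' : ∀ y : Fin n → F, (c - y ⬝ᵥ y = 0) = (y ⬝ᵥ y = c) := fun y => by
    rw [sub_eq_zero, eq_comm (a := c)]
  simp only [h', mul_ite, mul_one, mul_zero]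
  simp
  ring

theorem sphereCount_one (hF : ringChar F ≠ 2) (n : ℕ) :
    (sphereCount F n 1 : ℝ) = (quadraticChar F (-1) : ℝ) ^ (n + 1) *
      (spherePoly n).eval ((quadraticChar F (-1) : ℝ) * Fintype.card F) := by
  have hη : (quadraticChar F (-1) : ℝ) ^ 2 = 1 := by
    exact_mod_cast quadraticChar_sq_one (neg_ne_zero.mpr (one_ne_zero (α := F)))
  induction n using Nat.twoStepInduction with
  | zero => simp [sphereCount, spherePoly]
  | one =>
    have h : (sphereCount F 1 1 : ℤ) = 2 := by
      rw [sphereCount_eq_sum, sum_fin_succ_fun]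
      simp only [Matrix.cons_dotProduct_cons, Finset.univ_unique, Finset.sum_const,
        Finset.card_singleton, one_smul, Matrix.dotProduct_of_isEmpty, add_zero]
      rw [sum_comp_mul_self hF fun u => if u = 1 then (1 : ℤ) else 0]
      simp
    have h' : (sphereCount F 1 1 : ℝ) = 2 := by exact_mod_cast h
    rw [h', hη]
    simp [spherePoly]
  | more n ih _ =>
    have h : (sphereCount F (n + 2) 1 : ℝ) =
      Fintype.card F * quadraticChar F (-1) * sphereCount F n 1 +
        (Fintype.card F - quadraticChar F (-1)) * Fintype.card F ^ n := by
      exact_mod_cast sphereCount_add_two hF n (1 : F)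
    rw [h, ih, spherePoly]
    simp only [eval_add, eval_mul, eval_sub, eval_pow, eval_X, eval_one]
    generalize (quadraticChar F (-1) : ℝ) = η at *
    have hη' : (η ^ n) ^ 2 = 1 := by rw [← pow_mul, mul_comm, pow_mul, hη, one_pow]
    generalize eval _ (spherePoly n) = s at *
    generalize (Fintype.card F : ℝ) = q at *
    rw [mul_pow]
    linear_combination (-(q * η ^ (n + 2) * s) - (q * (η ^ 2 + 1) - η) * q ^ n) * hη -
      (η ^ 4 * q - η ^ 3) * q ^ n * hη'

end SphereCount

theorem sphereCount_one_pos (F : Type u) [Field F] [Finite F] (n : ℕ) :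
    0 < sphereCount F (n + 1) 1 := by
  rw [sphereCount]
  have : Nonempty {x : Fin (n + 1) → F // x ⬝ᵥ x = 1} := ⟨⟨Pi.single 0 1, by simp⟩⟩
  exact Nat.card_pos

/-! ### Counting symmetric sets. -/

section SymmetricSets

variable {n : ℕ}

/-- The residues `1, …, ⌊n/2⌋` modulo `n + 1`. -/
def lowerHalf (n : ℕ) : Finset (ZMod (n + 1)) :=
  Finset.univ.filter fun a => 0 < a.val ∧ 2 * a.val < n + 1

theorem mem_lowerHalf {a : ZMod (n + 1)} : a ∈ lowerHalf n ↔ 0 < a.val ∧ 2 * a.val < n + 1 := by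
  simp [lowerHalf]

theorem card_lowerHalf (n : ℕ) : (lowerHalf n).card = n / 2 := by
  have h : (lowerHalf n).image ZMod.val = Finset.Ioc 0 (n / 2) := by
    ext j
    simp only [Finset.mem_image, mem_lowerHalf, Finset.mem_Ioc]
    constructor
    · rintro ⟨a, ha, rfl⟩
      omega
    · intro hj
      have hv : ((j : ZMod (n + 1))).val = j := ZMod.val_cast_of_lt (by omega)
      exact ⟨j, by omega, hv⟩
  rw [← Finset.card_image_of_injective _ (ZMod.val_injective (n + 1)), h]
  simp

theorem ZMod.val_neg_add_val {a : ZMod (n + 1)} (ha : a ≠ 0) : (-a).val + a.val = n + 1 := by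
  have : NeZero a := ⟨ha⟩
  have := ZMod.val_neg_of_ne_zero a
  have := a.val_lt
  omega

theorem val_pos_of_ne_zero {a : ZMod (n + 1)} (ha : a ≠ 0) : 0 < a.val :=
  Nat.pos_of_ne_zero fun h => ha ((ZMod.val_eq_zero a).mp h)

/-- The elements of `ℤ/(n+1)ℤ` of order two: at most one. -/
def orderTwo (n : ℕ) : Finset (ZMod (n + 1)) :=
  Finset.univ.filter fun a => 2 * a.val = n + 1

theorem mem_orderTwo {a : ZMod (n + 1)} : a ∈ orderTwo n ↔ 2 * a.val = n + 1 := by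
  simp [orderTwo]

theorem card_orderTwo (n : ℕ) : (orderTwo n).card = n % 2 := by
  obtain ⟨m, rfl | rfl⟩ : ∃ m, n = 2 * m ∨ n = 2 * m + 1 := ⟨n / 2, by omega⟩
  · rw [show orderTwo (2 * m) = ∅ from Finset.eq_empty_of_forall_notMem fun a ha => by
      rw [mem_orderTwo] at ha; omega]
    simp
  · have hv : ((m + 1 : ℕ) : ZMod (2 * m + 1 + 1)).val = m + 1 := ZMod.val_cast_of_lt (by omega)
    rw [show orderTwo (2 * m + 1) = {((m + 1 : ℕ) : ZMod (2 * m + 1 + 1))} from ?_]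
    · simp
    · ext a
      rw [mem_orderTwo, Finset.mem_singleton]
      constructor
      · intro h
        exact ZMod.val_injective _ (by omega)
      · rintro rfl
        omega

theorem neg_mem_of_symmetric {A : Finset (ZMod (n + 1))} (hA : A = A.image fun a => -a)
    {a : ZMod (n + 1)} : -a ∈ A ↔ a ∈ A := by
  have h : ∀ b ∈ A, -b ∈ A := fun b hb => by
    rw [hA]
    exact Finset.mem_image_of_mem _ hb
  exact ⟨fun ha => by simpa using h _ ha, h a⟩

/-- The set `T ∪ -T ∪ E`. -/
def symmetrize (E T : Finset (ZMod (n + 1))) : Finset (ZMod (n + 1)) :=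
  T ∪ T.image (fun a => -a) ∪ E

theorem mem_symmetrize {E T : Finset (ZMod (n + 1))} {a : ZMod (n + 1)} :
    a ∈ symmetrize E T ↔ a ∈ T ∨ -a ∈ T ∨ a ∈ E := by
  simp only [symmetrize, Finset.mem_union, Finset.mem_image, or_assoc]
  refine or_congr_right (or_congr_left ⟨?_, fun h => ⟨-a, h, neg_neg a⟩⟩)
  rintro ⟨b, hb, rfl⟩
  rwa [neg_neg]

theorem card_symmetrize {E T : Finset (ZMod (n + 1))} (hT : T ⊆ lowerHalf n)
    (hE : E ⊆ orderTwo n) : (symmetrize E T).card = 2 * T.card + E.card := by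
  have h₁ : ∀ {a}, a ∈ T → 0 < a.val ∧ 2 * a.val < n + 1 := fun ha => mem_lowerHalf.mp (hT ha)
  have h₂ : ∀ {a}, a ∈ E → 2 * a.val = n + 1 := fun ha => mem_orderTwo.mp (hE ha)
  have h₃ : ∀ {a}, a ∈ T.image (fun a => -a) → n + 1 < 2 * a.val := by
    intro a ha
    obtain ⟨b, hb, rfl⟩ := Finset.mem_image.mp ha
    have := h₁ hb
    have := ZMod.val_neg_add_val (a := b) (by rintro rfl; simp at this)
    omega
  rw [symmetrize, Finset.card_union_of_disjoint, Finset.card_union_of_disjoint,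
    Finset.card_image_of_injective _ neg_injective, two_mul]
  · refine Finset.disjoint_left.mpr fun a ha hb => ?_
    have := h₁ ha
    have := h₃ hb
    omega
  · refine Finset.disjoint_left.mpr fun a ha hb => ?_
    have := h₂ hb
    rcases Finset.mem_union.mp ha with h | h
    · have := h₁ h
      omega
    · have := h₃ h
      omega

theorem symmetrize_inter {A : Finset (ZMod (n + 1))} (hA : A = A.image fun a => -a) (h0 : 0 ∉ A) :
    symmetrize (A ∩ orderTwo n) (A ∩ lowerHalf n) = A := by
  ext a
  rw [mem_symmetrize]
  simp only [Finset.mem_inter, neg_mem_of_symmetric hA, mem_lowerHalf, mem_orderTwo]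
  refine ⟨by tauto, fun ha => ?_⟩
  have hne : a ≠ 0 := fun h => h0 (h ▸ ha)
  have := ZMod.val_neg_add_val hne
  have := val_pos_of_ne_zero hne
  have := a.val_lt
  simp only [ha, true_and]
  omega

theorem isSymmetricSet_symmetrize {k : ℕ} {E T : Finset (ZMod (n + 1))} (hT : T ⊆ lowerHalf n)
    (hE : E ⊆ orderTwo n) (hk : 2 * T.card + E.card = k) : IsSymmetricSet n k (symmetrize E T) := by
  refine ⟨?_, ?_, (card_symmetrize hT hE).trans hk⟩
  · have hneg : ∀ a, a ∈ symmetrize E T → -a ∈ symmetrize E T := by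
      intro a
      simp only [mem_symmetrize, neg_neg]
      rintro (h | h | h)
      · exact Or.inr (Or.inl h)
      · exact Or.inl h
      · have h' := mem_orderTwo.mp (hE h)
        have := ZMod.val_neg_add_val (a := a) (by rintro rfl; simp at h')
        rw [show -a = a from ZMod.val_injective _ (by omega)]
        exact Or.inr (Or.inr h)
    ext a
    rw [Finset.mem_image]
    refine ⟨fun h => ⟨-a, hneg a h, neg_neg a⟩, ?_⟩
    rintro ⟨b, hb, rfl⟩
    exact hneg b hb
  · rw [mem_symmetrize]
    rintro (h | h | h)
    · simpa using mem_lowerHalf.mp (hT h)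
    · simpa using mem_lowerHalf.mp (hT h)
    · simpa using mem_orderTwo.mp (hE h)

/-- A symmetric set without 0 is determined by its lower half and its element of order two, if any.
The parity of k decides whether that element belongs, leaving k/2 of the n/2 lower residues to
choose. -/
theorem ncard_isSymmetricSet (n k : ℕ) :
    Set.ncard {A : Finset (ZMod (n + 1)) | IsSymmetricSet n k A} = symmetricCount n k := by
  have hcard : ∀ {A}, IsSymmetricSet n k A →
      2 * (A ∩ lowerHalf n).card + (A ∩ orderTwo n).card = k := fun {A} hA => by
    rw [← card_symmetrize Finset.inter_subset_right Finset.inter_subset_right,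
      symmetrize_inter hA.1 hA.2.1, hA.2.2]
  have hle : ∀ A, (A ∩ orderTwo n).card ≤ n % 2 := fun A =>
    card_orderTwo n ▸ Finset.card_le_card Finset.inter_subset_right
  rw [symmetricCount]
  split_ifs with h
  · rw [Set.ncard_eq_zero, Set.eq_empty_iff_forall_notMem]
    intro A hA
    have := hcard hA
    have := hle A
    grind
  · obtain ⟨E, hE, hEk⟩ : ∃ E ⊆ orderTwo n, E.card = k % 2 :=
      Finset.exists_subset_card_eq (by rw [card_orderTwo]; grind)
    have hset : {A : Finset (ZMod (n + 1)) | IsSymmetricSet n k A} =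
        (((lowerHalf n).powersetCard (k / 2)).image (symmetrize E) :
          Finset (Finset (ZMod (n + 1)))) := by
      ext A
      simp only [Set.mem_ofPred_eq, Finset.coe_image, Set.mem_image, Finset.mem_coe,
        Finset.mem_powersetCard]
      constructor
      · intro hA
        have h₁ := hcard hA
        have h₂ := hle A
        refine ⟨A ∩ lowerHalf n, ⟨Finset.inter_subset_right, by omega⟩, ?_⟩
        -- `orderTwo n` has at most one element, so a subset of it is determined by its cardinality.
        have hE' : E = A ∩ orderTwo n := by
          have hc : (A ∩ orderTwo n).card = k % 2 := by omega
          rcases Nat.mod_two_eq_zero_or_one k with h0 | h1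
          · rw [Finset.card_eq_zero.mp (hEk.trans h0), Finset.card_eq_zero.mp (hc.trans h0)]
          · rw [Finset.eq_of_subset_of_card_le hE (by rw [card_orderTwo]; omega),
              Finset.eq_of_subset_of_card_le (Finset.inter_subset_right (s₁ := A))
                (by rw [card_orderTwo]; omega)]
        rw [hE']
        exact symmetrize_inter hA.1 hA.2.1
      · rintro ⟨T, ⟨hT, hTk⟩, rfl⟩
        exact isSymmetricSet_symmetrize hT hE (by omega)
    rw [hset, Set.ncard_coe_finset, Finset.card_image_of_injOn, Finset.card_powersetCard,
      card_lowerHalf]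
    intro T hT T' hT' heq
    have key : ∀ S ∈ (lowerHalf n).powersetCard (k / 2), symmetrize E S ∩ lowerHalf n = S := by
      intro S hS
      have hS' := (Finset.mem_powersetCard.mp hS).1
      ext a
      rw [Finset.mem_inter, mem_symmetrize]
      refine ⟨?_, fun ha => ⟨Or.inl ha, hS' ha⟩⟩
      rintro ⟨h | h | h, ha⟩
      · exact h
      · have h₁ := mem_lowerHalf.mp (hS' h)
        have h₂ := mem_lowerHalf.mp ha
        have := ZMod.val_neg_add_val (a := a) (by rintro rfl; simp at h₂)
        omega
      · have h₁ := mem_orderTwo.mp (hE h)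
        have h₂ := mem_lowerHalf.mp ha
        omega
    rw [← key T hT, ← key T' hT']
    exact congrArg (· ∩ lowerHalf n) heq

end SymmetricSets

/-! ### Orthonormal frames and dot-subspaces. -/

section Frames

open Matrix

variable {F : Type u} [Field F]

/-- The reflection along `w`, acting on row vectors. -/
def reflectionMatrix {n : ℕ} (w : Fin n → F) : Matrix (Fin n) (Fin n) F :=
  1 - (2 / (w ⬝ᵥ w)) • vecMulVec w w

theorem vecMul_reflectionMatrix {n : ℕ} (w x : Fin n → F) :
    x ᵥ* reflectionMatrix w = x - (2 * (x ⬝ᵥ w) / (w ⬝ᵥ w)) • w := by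
  rw [reflectionMatrix, vecMul_sub, vecMul_one, vecMul_smul, vecMul_vecMulVec, smul_smul]
  congr 2
  ring

theorem reflectionMatrix_mul_transpose {n : ℕ} {w : Fin n → F} (hw : w ⬝ᵥ w ≠ 0) :
    reflectionMatrix w * (reflectionMatrix w)ᵀ = 1 := by
  have ht : (reflectionMatrix w)ᵀ = reflectionMatrix w := by
    simp [reflectionMatrix, transpose_sub, transpose_smul, transpose_vecMulVec]
  rw [ht]
  suffices h : ∀ x : Fin n → F, x ᵥ* (reflectionMatrix w * reflectionMatrix w) = x ᵥ* 1 by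
    ext i j
    have hi := h (Pi.single i 1)
    rw [single_one_vecMul, single_one_vecMul] at hi
    exact congrFun hi j
  intro x
  rw [← vecMul_vecMul, vecMul_one, vecMul_reflectionMatrix, vecMul_reflectionMatrix,
    sub_dotProduct, smul_dotProduct, sub_sub, ← add_smul]
  generalize x ⬝ᵥ w = t
  have h : 2 * t / (w ⬝ᵥ w) + 2 * (t - (2 * t / (w ⬝ᵥ w)) • (w ⬝ᵥ w)) / (w ⬝ᵥ w) = 0 := by
    rw [smul_eq_mul]
    field_simp
    ring
  rw [h, zero_smul, sub_zero]

/-- If x - y is not isotropic, the reflection along it swaps x and y. Otherwise x·y = 1, so x + y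
has norm 4 ≠ 0 and minus the reflection along x + y sends x to y. -/
theorem exists_orthogonal_vecMul_eq (hF : (2 : F) ≠ 0) {n : ℕ} {x y : Fin n → F}
    (hx : x ⬝ᵥ x = 1) (hy : y ⬝ᵥ y = 1) :
    ∃ R : Matrix (Fin n) (Fin n) F, R * Rᵀ = 1 ∧ x ᵥ* R = y := by
  by_cases hw : (x - y) ⬝ᵥ (x - y) = 0
  · have hw' : (x - y) ⬝ᵥ (x - y) = 2 * (1 - x ⬝ᵥ y) := by
      simp only [sub_dotProduct, dotProduct_sub, hx, hy, dotProduct_comm y x]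
      ring
    have hxy : x ⬝ᵥ y = 1 := by
      rw [hw'] at hw
      linear_combination -(mul_eq_zero.mp hw).resolve_left hF
    have hz : (x + y) ⬝ᵥ (x + y) = 2 * 2 := by
      simp only [add_dotProduct, dotProduct_add, hx, hy, dotProduct_comm y x, hxy]
      ring
    have hz0 : (x + y) ⬝ᵥ (x + y) ≠ 0 := hz ▸ mul_ne_zero hF hF
    refine ⟨-reflectionMatrix (x + y), ?_, ?_⟩
    · rw [transpose_neg, neg_mul_neg, reflectionMatrix_mul_transpose hz0]
    · rw [vecMul_neg, vecMul_reflectionMatrix, hz, dotProduct_add, hx, hxy,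
        show (2 * (1 + 1) / (2 * 2) : F) = 1 by field_simp; ring, one_smul]
      abel
  · refine ⟨reflectionMatrix (x - y), reflectionMatrix_mul_transpose hw, ?_⟩
    rw [vecMul_reflectionMatrix, show 2 * (x ⬝ᵥ (x - y)) / ((x - y) ⬝ᵥ (x - y)) = 1 from ?_,
      one_smul, sub_sub_cancel]
    rw [div_eq_one_iff_eq hw]
    simp only [sub_dotProduct, dotProduct_sub, hx, hy, dotProduct_comm y x]
    ring

/-- The number of orthonormal `k`-tuples in `(Fⁿ, dot_n)`, as matrices with orthonormal rows. -/
noncomputable def frameCount (F : Type u) [Field F] (n k : ℕ) : ℕ :=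
  Nat.card {A : Matrix (Fin k) (Fin n) F // A * Aᵀ = 1}

theorem frameCount_zero (n : ℕ) : frameCount F n 0 = 1 := by
  rw [frameCount, Nat.card_eq_one_iff_unique]
  exact ⟨inferInstance, ⟨0, Subsingleton.elim _ _⟩⟩

/-- The block matrix with diagonal blocks `1` and `B`. -/
def oneBlock {k n : ℕ} (B : Matrix (Fin k) (Fin n) F) : Matrix (Fin (k + 1)) (Fin (n + 1)) F :=
  of (vecCons (vecCons 1 0) fun i => vecCons 0 (B i))

theorem oneBlock_mul_transpose {k n : ℕ} {B : Matrix (Fin k) (Fin n) F} (hB : B * Bᵀ = 1) :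
    oneBlock B * (oneBlock B)ᵀ = 1 := by
  have hB' : ∀ i j, B i ⬝ᵥ B j = (1 : Matrix (Fin k) (Fin k) F) i j := fun i j => by
    rw [← hB]
    rfl
  ext i j
  change oneBlock B i ⬝ᵥ oneBlock B j = _
  refine Fin.cases ?_ (fun i => ?_) i <;> refine Fin.cases ?_ (fun j => ?_) j
  · change vecCons 1 0 ⬝ᵥ vecCons 1 0 = _
    simp
  · change vecCons 1 0 ⬝ᵥ vecCons 0 (B j) = _
    simp [one_apply_ne (Fin.succ_ne_zero j).symm]
  · change vecCons 0 (B i) ⬝ᵥ vecCons 1 0 = _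
    simp [one_apply_ne (Fin.succ_ne_zero i)]
  · change vecCons 0 (B i) ⬝ᵥ vecCons 0 (B j) = _
    simp [hB', one_apply]

/-- Fix for each unit vector v an orthogonal `R v` taking the first basis vector to v. Undoing `R v`
on a frame that starts with v makes its first row that basis vector; the remaining rows then have
first coordinate 0 and form a k-frame in dimension n. -/
theorem frameCount_succ_succ (hF : (2 : F) ≠ 0) (n k : ℕ) :
    frameCount F (n + 1) (k + 1) = sphereCount F (n + 1) 1 * frameCount F n k := by
  have he : (vecCons 1 0 : Fin (n + 1) → F) ⬝ᵥ vecCons 1 0 = 1 := by simp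
  choose R hR hRv using fun v : {x : Fin (n + 1) → F // x ⬝ᵥ x = 1} =>
    exists_orthogonal_vecMul_eq hF he v.2
  have hR' : ∀ v, (R v)ᵀ * R v = 1 := fun v => mul_eq_one_comm.mp (hR v)
  rw [sphereCount, frameCount, frameCount, ← Nat.card_prod]
  have hmem : ∀ v, ∀ B : Matrix (Fin k) (Fin n) F, B * Bᵀ = 1 →
      oneBlock B * R v * (oneBlock B * R v)ᵀ = 1 := fun v B hB => by
    rw [transpose_mul, Matrix.mul_assoc, ← Matrix.mul_assoc (R v), hR, Matrix.one_mul,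
      oneBlock_mul_transpose hB]
  refine (Nat.card_eq_of_bijective
    (fun p => ⟨oneBlock p.2.1 * R p.1, hmem p.1 p.2.1 p.2.2⟩) ⟨?_, ?_⟩).symm
  · rintro ⟨v, B⟩ ⟨v', B'⟩ h
    have h₁ : oneBlock B.1 * R v = oneBlock B'.1 * R v' := congrArg Subtype.val h
    have hv : v = v' := by
      refine Subtype.ext ?_
      rw [← hRv v, ← hRv v']
      exact congrFun h₁ 0
    subst hv
    have h₂ : oneBlock B.1 = oneBlock B'.1 := by
      have := congrArg (· * (R v)ᵀ) h₁
      simpa [Matrix.mul_assoc, hR] using this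
    refine Prod.ext rfl (Subtype.ext ?_)
    ext i j
    exact congrFun (congrFun h₂ i.succ) j.succ
  · rintro ⟨A, hA⟩
    have hA' : ∀ i j, A i ⬝ᵥ A j = (1 : Matrix (Fin (k + 1)) (Fin (k + 1)) F) i j := fun i j => by
      rw [← hA]
      rfl
    set v : {x : Fin (n + 1) → F // x ⬝ᵥ x = 1} := ⟨A 0, by rw [hA', one_apply_eq]⟩
    set D := A * (R v)ᵀ with hD
    have hD0 : D 0 = vecCons 1 0 := by
      change A 0 ᵥ* (R v)ᵀ = _
      rw [show A 0 = _ from (hRv v).symm, vecMul_vecMul, hR, vecMul_one]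
    have hDD : D * Dᵀ = 1 := by
      rw [hD, transpose_mul, transpose_transpose, Matrix.mul_assoc, ← Matrix.mul_assoc _ (R v),
        hR', Matrix.one_mul, hA]
    have hDi : ∀ i : Fin k, D i.succ 0 = 0 := by
      intro i
      have h : D i.succ ⬝ᵥ D 0 = (D * Dᵀ) i.succ 0 := rfl
      rw [hDD, one_apply_ne (Fin.succ_ne_zero i), hD0] at h
      have h' := dotProduct_cons (D i.succ) (1 : F) (0 : Fin n → F)
      rw [h] at h'
      simpa [vecHead] using h'.symm
    have hDB : oneBlock (D.submatrix Fin.succ Fin.succ) = D := by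
      ext i j
      refine Fin.cases ?_ (fun i => ?_) i
      · rw [hD0]
        rfl
      · refine Fin.cases ?_ (fun j => ?_) j
        · rw [hDi]
          rfl
        · rfl
    refine ⟨⟨v, D.submatrix Fin.succ Fin.succ, ?_⟩, Subtype.ext ?_⟩
    · ext i j
      have h := congrFun (congrFun hDD i.succ) j.succ
      change D i.succ ⬝ᵥ D j.succ = _ at h
      have h' : D i.succ = vecCons 0 (D.submatrix Fin.succ Fin.succ i) := by
        nth_rw 1 [← hDB]
        rfl
      have h'' : D j.succ = vecCons 0 (D.submatrix Fin.succ Fin.succ j) := by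
        nth_rw 1 [← hDB]
        rfl
      rw [h', h'', cons_dotProduct_cons, mul_zero, zero_add] at h
      refine h.trans ?_
      simp [one_apply]
    · change oneBlock (D.submatrix Fin.succ Fin.succ) * R v = A
      rw [hDB, hD, Matrix.mul_assoc, hR', Matrix.mul_one]

theorem dotForm_eq_dotProduct (n : ℕ) (x : Fin n → F) : dotForm F n x = x ⬝ᵥ x := by
  simp [dotForm_apply, dotProduct, pow_two]

theorem vecMul_dotProduct_vecMul {n k : ℕ} {A : Matrix (Fin k) (Fin n) F} (hA : A * Aᵀ = 1)
    (x y : Fin k → F) : (x ᵥ* A) ⬝ᵥ (y ᵥ* A) = x ⬝ᵥ y := by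
  rw [← mulVec_transpose A y, dotProduct_mulVec, vecMul_vecMul, hA, vecMul_one]

/-- Polarization, which is where 2 must be invertible. -/
theorem mul_transpose_eq_one_of_forall_dotProduct (hF : (2 : F) ≠ 0) {n k : ℕ}
    {A : Matrix (Fin k) (Fin n) F} (h : ∀ x, (x ᵥ* A) ⬝ᵥ (x ᵥ* A) = x ⬝ᵥ x) : A * Aᵀ = 1 := by
  have h' : ∀ x y, (x ᵥ* A) ⬝ᵥ (y ᵥ* A) = x ⬝ᵥ y := by
    intro x y
    have hxy := h (x + y)
    simp only [add_vecMul, add_dotProduct, dotProduct_add, h,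
      dotProduct_comm (y ᵥ* A) (x ᵥ* A), dotProduct_comm y x] at hxy
    refine mul_left_cancel₀ hF ?_
    linear_combination hxy
  ext i j
  have hij := h' (Pi.single i 1) (Pi.single j 1)
  rw [single_one_vecMul, single_one_vecMul] at hij
  refine Eq.trans hij ?_
  simp [one_apply, Pi.single_apply, eq_comm (a := j)]

/-- The rows of A are the images of the standard basis under an isometry onto W. -/
theorem isDotSubspace_iff (hF : (2 : F) ≠ 0) {n k : ℕ} {W : Submodule F (Fin n → F)} :
    IsDotSubspace F n k W ↔
      ∃ A : Matrix (Fin k) (Fin n) F, A * Aᵀ = 1 ∧ LinearMap.range A.vecMulLinear = W := by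
  constructor
  · rintro ⟨e⟩
    set φ : (Fin k → F) →ₗ[F] (Fin n → F) :=
      W.subtype ∘ₗ (e.toLinearEquiv.symm : (Fin k → F) →ₗ[F] W) with hφ
    have hA : ((LinearMap.toMatrix' φ)ᵀ).vecMulLinear = φ := by
      refine LinearMap.ext fun x => ?_
      rw [vecMulLinear_apply, vecMul_transpose, LinearMap.toMatrix'_mulVec]
    refine ⟨(LinearMap.toMatrix' φ)ᵀ, mul_transpose_eq_one_of_forall_dotProduct hF fun x => ?_, ?_⟩
    · rw [← vecMulLinear_apply, hA, ← dotForm_eq_dotProduct, ← dotForm_eq_dotProduct]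
      have := e.map_app' (e.toLinearEquiv.symm x)
      refine this.symm.trans (congrArg _ ?_)
      exact e.toLinearEquiv.apply_symm_apply x
    · rw [hA, hφ, LinearMap.range_comp, LinearEquiv.range, Submodule.map_top,
        Submodule.range_subtype]
  · rintro ⟨A, hA, rfl⟩
    have hinj : Function.Injective A.vecMulLinear := by
      intro x y hxy
      have := congrArg (· ᵥ* Aᵀ) hxy
      simpa [vecMul_vecMul, hA] using this
    refine ⟨QuadraticMap.IsometryEquiv.symm ⟨LinearEquiv.ofInjective _ hinj, fun x => ?_⟩⟩
    change dotForm F n (x ᵥ* A) = dotForm F k x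
    rw [dotForm_eq_dotProduct, dotForm_eq_dotProduct, vecMul_dotProduct_vecMul hA]

/-- Group k-frames by their span W: once one frame `A W` is fixed, the others are `B * A W` for a
unique orthogonal B. -/
theorem dotBinom_mul_frameCount (hF : (2 : F) ≠ 0) (n k : ℕ) :
    dotBinom F n k * frameCount F k k = frameCount F n k := by
  choose A hA hAW using fun W : {W : Submodule F (Fin n → F) // IsDotSubspace F n k W} =>
    (isDotSubspace_iff hF).mp W.2
  rw [dotBinom, ← Nat.card_coe_set_eq, frameCount, frameCount, ← Nat.card_prod]
  change Nat.card ({W : Submodule F (Fin n → F) // IsDotSubspace F n k W} × _) = _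
  have hmem : ∀ W, ∀ B : Matrix (Fin k) (Fin k) F, B * Bᵀ = 1 → B * A W * (B * A W)ᵀ = 1 :=
    fun W B hB => by
      rw [transpose_mul, Matrix.mul_assoc, ← Matrix.mul_assoc (A W), hA, Matrix.one_mul, hB]
  refine Nat.card_eq_of_bijective (fun p => ⟨p.2.1 * A p.1, hmem p.1 p.2.1 p.2.2⟩) ⟨?_, ?_⟩
  · have hrange : ∀ W (B : {B : Matrix (Fin k) (Fin k) F // B * Bᵀ = 1}),
        LinearMap.range (B.1 * A W).vecMulLinear = W.1 := by
      intro W B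
      rw [← hAW W]
      ext y
      simp only [LinearMap.mem_range, vecMulLinear_apply]
      constructor
      · rintro ⟨x, rfl⟩
        exact ⟨x ᵥ* B.1, vecMul_vecMul _ _ _⟩
      · rintro ⟨x, rfl⟩
        refine ⟨x ᵥ* B.1ᵀ, ?_⟩
        rw [vecMul_vecMul, ← Matrix.mul_assoc, mul_eq_one_comm.mp B.2, Matrix.one_mul]
    rintro ⟨W, B⟩ ⟨W', B'⟩ h
    have h₁ : B.1 * A W = B'.1 * A W' := congrArg Subtype.val h
    have hW : W = W' := Subtype.ext (by rw [← hrange W B, ← hrange W' B', h₁])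
    subst hW
    have h₂ := congrArg (· * (A W)ᵀ) h₁
    simp only [Matrix.mul_assoc, hA, Matrix.mul_one] at h₂
    exact Prod.ext rfl (Subtype.ext h₂)
  · rintro ⟨D, hD⟩
    set W : {W : Submodule F (Fin n → F) // IsDotSubspace F n k W} :=
      ⟨LinearMap.range D.vecMulLinear, (isDotSubspace_iff hF).mpr ⟨D, hD, rfl⟩⟩
    have hrow : ∀ i, ∃ x, x ᵥ* A W = D i := by
      intro i
      have h : D i ∈ LinearMap.range (A W).vecMulLinear := by
        rw [hAW W]
        exact ⟨Pi.single i 1, single_one_vecMul i D⟩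
      exact h
    choose B hB using hrow
    have hBD : of B * A W = D := by
      ext i j
      exact congrFun (hB i) j
    refine ⟨⟨W, of B, ?_⟩, Subtype.ext hBD⟩
    rw [← hD, ← hBD, transpose_mul, Matrix.mul_assoc, ← Matrix.mul_assoc (A W), hA, Matrix.one_mul]

end Frames

/-! ### Orthogonal group orders and the quotient formula. -/

theorem frameCount_mul_frameCount {F : Type u} [Field F] (hF : (2 : F) ≠ 0) (k l : ℕ) :
    frameCount F (k + l) k * frameCount F l l = frameCount F (k + l) (k + l) := by
  induction k with
  | zero => rw [frameCount_zero, one_mul, zero_add]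
  | succ k ih =>
    rw [show k + 1 + l = k + l + 1 by ring, frameCount_succ_succ hF, frameCount_succ_succ hF,
      mul_assoc, ih]

/-- Sign bookkeeping for `frameCount_self`: the sphere in dimension n + 1 contributes η^(n+2) = η^n.
-/
theorem pow_succ_div_two_of_sq_eq_one {η : ℝ} (hη : η ^ 2 = 1) (n : ℕ) :
    η ^ ((n + 1) / 2) = η ^ (n / 2) * η ^ n := by
  obtain ⟨m, rfl | rfl⟩ : ∃ m, n = 2 * m ∨ n = 2 * m + 1 := ⟨n / 2, by omega⟩
  · rw [show (2 * m + 1) / 2 = m by omega, show 2 * m / 2 = m by omega, pow_mul, hη, one_pow,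
      mul_one]
  · rw [show (2 * m + 1 + 1) / 2 = m + 1 by omega, show (2 * m + 1) / 2 = m by omega,
      pow_succ η (2 * m), pow_mul, hη, one_pow, one_mul, pow_succ]

theorem frameCount_self_pos {F : Type u} [Field F] [Finite F] (hF : ringChar F ≠ 2) (n : ℕ) : 0 < frameCount F n n := by
  induction n with
  | zero => simp [frameCount_zero]
  | succ n ih =>
    rw [frameCount_succ_succ (Ring.two_ne_zero hF)]
    exact Nat.mul_pos (sphereCount_one_pos F n) ih

section Count

variable {F : Type u} [Field F] [Fintype F] [DecidableEq F]

theorem frameCount_self (hF : ringChar F ≠ 2) (n : ℕ) :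
    (frameCount F n n : ℝ) = (quadraticChar F (-1) : ℝ) ^ (n / 2) *
      (orthoPoly n).eval ((quadraticChar F (-1) : ℝ) * Fintype.card F) := by
  have hη : (quadraticChar F (-1) : ℝ) ^ 2 = 1 := by
    exact_mod_cast quadraticChar_sq_one (neg_ne_zero.mpr (one_ne_zero (α := F)))
  induction n with
  | zero => simp [frameCount_zero, orthoPoly]
  | succ n ih =>
    rw [frameCount_succ_succ (Ring.two_ne_zero hF), Nat.cast_mul, ih, sphereCount_one hF,
      orthoPoly_succ, eval_mul, pow_succ_div_two_of_sq_eq_one hη, add_assoc, pow_add _ n 2, hη]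
    ring

/-- Since η is its own inverse, the sign exponents of the denominators are added, not subtracted. -/
theorem dotBinom_add_eq_eval (hF : ringChar F ≠ 2) {k l : ℕ} {P : ℝ[X]}
    (hP : orthoPoly (k + l) = P * orthoPoly k * orthoPoly l) :
    (dotBinom F (k + l) k : ℝ) =
      (quadraticChar F (-1) : ℝ) ^ ((k + l) / 2 + k / 2 + l / 2) *
        P.eval ((quadraticChar F (-1) : ℝ) * Fintype.card F) := by
  have hη : (quadraticChar F (-1) : ℝ) ^ 2 = 1 := by
    exact_mod_cast quadraticChar_sq_one (neg_ne_zero.mpr (one_ne_zero (α := F)))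
  have h : (dotBinom F (k + l) k : ℝ) * frameCount F k k * frameCount F l l =
      frameCount F (k + l) (k + l) := by
    rw [← frameCount_mul_frameCount (Ring.two_ne_zero hF),
      ← dotBinom_mul_frameCount (Ring.two_ne_zero hF) (k + l) k]
    push_cast
    rfl
  have hk : (frameCount F k k : ℝ) ≠ 0 := by exact_mod_cast (frameCount_self_pos hF k).ne'
  have hl : (frameCount F l l : ℝ) ≠ 0 := by exact_mod_cast (frameCount_self_pos hF l).ne'
  refine mul_right_cancel₀ hk (mul_right_cancel₀ hl ?_)
  rw [h, frameCount_self hF, frameCount_self hF k, frameCount_self hF l, hP, eval_mul, eval_mul,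
    pow_add, pow_add]
  generalize (quadraticChar F (-1) : ℝ) = η at *
  have hη' : ∀ m, (η ^ m) ^ 2 = 1 := fun m => by rw [← pow_mul, mul_comm, pow_mul, hη, one_pow]
  generalize eval _ P = p
  generalize eval _ (orthoPoly k) = s
  generalize eval _ (orthoPoly l) = t
  linear_combination (-(η ^ ((k + l) / 2) * p * s * t)) * hη' (k / 2) -
    (η ^ ((k + l) / 2) * p * s * t) * (η ^ (k / 2)) ^ 2 * hη' (l / 2)

end Count

/-! ### Uniqueness, existence and limits. -/

/-- By Dirichlet's theorem the residue class contains infinitely many primes, so the two polynomials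
agree at infinitely many points. -/
theorem isDotBinomPolynomial_unique {r n k : ℕ} (hr : Nat.Coprime r 4) {P Q : ℝ[X]}
    (hP : IsDotBinomPolynomial.{u} r n k P) (hQ : IsDotBinomPolynomial.{u} r n k Q) : P = Q := by
  refine eq_of_infinite_eval_eq P Q (Set.Infinite.mono ?_
    ((Nat.infinite_setOfPred_prime_and_modEq (by norm_num) hr).image
      (f := fun p : ℕ => (p : ℝ)) Nat.cast_injective.injOn))
  rintro _ ⟨p, ⟨hp, hpr⟩, rfl⟩
  have : Fact p.Prime := ⟨hp⟩
  -- `ULift` places the prime field in the universe over which the fields range.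
  have hc : Nat.card (ULift.{u} (ZMod p)) = p := by rw [Nat.card_ulift, Nat.card_zmod]
  have h₁ := hP (ULift.{u} (ZMod p)) (by rwa [hc])
  have h₂ := hQ (ULift.{u} (ZMod p)) (by rwa [hc])
  rw [hc] at h₁ h₂
  exact h₁.symm.trans h₂

theorem exists_isDotBinomPolynomial {r k l : ℕ} {η : ℤ} (hη : η ^ 2 = 1) (hr : Odd r)
    (hχ : ZMod.χ₄ r = η) (hk : 0 < k) (hl : 0 < l) :
    ∃ P : ℝ[X], IsDotBinomPolynomial.{u} r (k + l) k P ∧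
      P.eval (η : ℝ) = symmetricCount (k + l) k := by
  have hη' : (η : ℝ) ^ 2 = 1 := by exact_mod_cast hη
  obtain ⟨P, hP, hP1⟩ := exists_orthoPoly_add hk hl
  -- Substituting ηX makes evaluation at η fall on P(η²) = P(1).
  refine ⟨C ((η : ℝ) ^ ((k + l) / 2 + k / 2 + l / 2)) * P.comp (C (η : ℝ) * X), ?_, ?_⟩
  · intro F _ _ hF
    classical
    have := Fintype.ofFinite F
    rw [Nat.card_eq_fintype_card] at hF ⊢
    have hchar : ringChar F ≠ 2 := by
      intro h
      have h₁ := FiniteField.even_card_of_char_two h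
      have h₂ : Fintype.card F % 4 = r % 4 := hF
      grind
    have hq : quadraticChar F (-1) = η := by
      rw [quadraticChar_neg_one hchar, ← hχ, (ZMod.natCast_eq_natCast_iff _ _ _).mpr hF]
    rw [dotBinom_add_eq_eval hchar hP, hq]
    simp
  · simp only [eval_mul, eval_C, eval_comp, eval_X, ← pow_two, hη', hP1]
    -- In this case the value is 0 and the sign is irrelevant; in all others the sign exponent is
    -- even.
    by_cases h : Even (k + l) ∧ Odd k
    · simp [symmetricCount, h]
    · rw [show (k + l) / 2 + k / 2 + l / 2 = 2 * (k / 2 + l / 2) by grind, pow_mul, hη', one_pow,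
        one_mul]

theorem mainTheorem9 (n k : ℕ) (hk : 0 < k) (hkn : k < n) :
    ∃ (P₁ P₃ : ℝ[X]) (L : ℕ),
      (∀ P : ℝ[X], IsDotBinomPolynomial.{u} 1 n k P ↔ P = P₁) ∧
      (∀ P : ℝ[X], IsDotBinomPolynomial.{u} 3 n k P ↔ P = P₃) ∧
      Filter.Tendsto (fun q : ℝ => P₁.eval q) (nhdsWithin 1 {1}ᶜ) (nhds (L : ℝ)) ∧
      Filter.Tendsto (fun q : ℝ => P₃.eval q) (nhdsWithin (-1) {-1}ᶜ) (nhds (L : ℝ)) ∧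
      (Odd n → Odd k → L = ((n - 1) / 2).choose ((k - 1) / 2)) ∧
      (Odd n → Even k → L = ((n - 1) / 2).choose (k / 2)) ∧
      (Even n → Even k → L = (n / 2).choose (k / 2)) ∧
      (Even n → Odd k → L = 0) ∧
      Set.ncard {A : Finset (ZMod (n + 1)) | IsSymmetricSet n k A} = L := by
  obtain ⟨l, rfl⟩ := Nat.exists_eq_add_of_lt hkn
  rw [add_assoc k l 1]
  obtain ⟨P₁, h₁, e₁⟩ := exists_isDotBinomPolynomial.{u} (r := 1) (η := 1) (by norm_num)
    odd_one (by decide) hk l.succ_pos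
  obtain ⟨P₃, h₃, e₃⟩ := exists_isDotBinomPolynomial.{u} (r := 3) (η := -1) (by norm_num)
    (by decide) (by decide) hk l.succ_pos
  rw [Int.cast_one] at e₁
  rw [Int.cast_neg, Int.cast_one] at e₃
  change eval 1 P₁ = ((symmetricCount (k + (l + 1)) k : ℕ) : ℝ) at e₁
  change eval (-1) P₃ = ((symmetricCount (k + (l + 1)) k : ℕ) : ℝ) at e₃
  generalize k + (l + 1) = n at *
  refine ⟨P₁, P₃, symmetricCount n k,
    fun P => ⟨fun h => isDotBinomPolynomial_unique (by norm_num) h h₁, fun h => h ▸ h₁⟩,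
    fun P => ⟨fun h => isDotBinomPolynomial_unique (by norm_num) h h₃, fun h => h ▸ h₃⟩,
    ?_, ?_, fun hn hk => ?_, fun hn hk => ?_, fun hn hk => ?_, fun hn hk => ?_,
    ncard_isSymmetricSet n k⟩
  · rw [← e₁]
    exact P₁.continuous.continuousWithinAt
  · rw [← e₃]
    exact P₃.continuous.continuousWithinAt
  · rw [symmetricCount, if_neg (by grind), show (n - 1) / 2 = n / 2 by grind,
      show (k - 1) / 2 = k / 2 by grind]
  · rw [symmetricCount, if_neg (by grind), show (n - 1) / 2 = n / 2 by grind]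
  · rw [symmetricCount, if_neg (by grind)]
  · rw [symmetricCount, if_pos ⟨hn, hk⟩]
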